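/- Let $\mathbb{K}\in\{\mathbb{R},\mathbb{C}\}$, let $\Omega$ be a non-empty set, and let $(\mathcal{F},\tau)$ be a bornological locally convex Hausdorff space whose underlying vector space is a linear space of $\mathbb{K}$-valued functions on $\Omega$. Assume that $(\mathcal{F},\tau)$ is a BC-space, i.e. for every Banach space $E$ every linear map $E\to(\mathcal{F},\tau)$ with closed graph is continuous. Let $\mathcal{B}$ be the family of $\tau$-bounded subsets of $\mathcal{F}$, and let $\widetilde{\tau}$ be a locally convex Hausdorff topology on $\mathcal{F}$ which is finer than or equal to the topology $\tau_{\mathrm{p}}$ of pointwise convergence on $\Omega$ and such that - (BBC) every $B\in\mathcal{B}$ is contained in an absolutely convex $\tau$-bounded $\widetilde{\tau}$-compact set; - (CNC) $\tau$ has a $0$-neighbourhood basis consisting of absolutely convex $\widetilde{\tau}$-closed sets. Let $\mathcal{F}_{\mathcal{B},\widetilde{\tau}}'$ be the space of all linear functionals on $\mathcal{F}$ whose restriction to each $B\in\mathcal{B}$ is $\widetilde{\tau}$-continuous, equipped with the topology of uniform convergence on the sets $B\in\mathcal{B}$. Let $\mathcal{C}$ be a class of complete barrelled locally convex Hausdorff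 spaces over $\mathbb{K}$ that is closed under topological isomorphisms and contains $\mathcal{F}_{\mathcal{B},\widetilde{\tau}}'$. A predual of $(\mathcal{F},\tau)$ is a pair $(Z,\varphi)$ of a locally convex Hausdorff space $Z$ and a (linear) topological isomorphism $\varphi\colon(\mathcal{F},\tau)\to Z_b'$ onto the strong dual of $Z$; $(\mathcal{F},\tau)$ is a dual space if it has a predual. A dual space $X$ has a strongly unique $\mathcal{C}$ predual if for all preduals $(Y,\varphi)$, $(Z,\psi)$ of $X$ with $Y,Z\in\mathcal{C}$ and every topological isomorphism $\alpha\colon Z_b'\to Y_b'$ there is a topological isomorphism $\lambda\colon Y\to Z$ with $\alpha(z')=z'\circ\lambda$ for all $z'\in Z'$. Then the following assertions are equivalent. (a) $(\mathcal{F},\tau)$ is a dual space and has a strongly unique $\mathcal{C}$ predual. (b) For every predual $(Z,\varphi)$ of $(\mathcal{F},\tau)$ such that $Z\in\mathcal{C}$ and every $x\in\Omega$ there is $z_x\in Z$ with $f(x)=\varphi(f)(z_x)$ for all $f\in\mathcal{F}$. Moreover, for every predual $(Z,\varphi)$ of $(\mathcal{F},\tau)$ with $Z\in\mathcal{C}$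 and every $x\in\Omega$, there is at most one $z_x\in Z$ as in (b). -/

import Mathlib

open scoped Topology ComplexOrder

universe u v

/-! Locally convex spaces over `𝕜 = ℝ` or `ℂ`.  Since several topologies live on the same vector
space, the topologies are explicit arguments. -/

/-- `τ` is a locally convex Hausdorff (vector space) topology on `X`. -/
structure IsLCHausdorff (𝕜 : Type v) [RCLike 𝕜] {X : Type u} [AddCommGroup X] [Module 𝕜 X]
    (τ : TopologicalSpace X) : Prop where
  isTopologicalAddGroup : IsTopologicalAddGroup X
  continuousSMul : ContinuousSMul 𝕜 X
  t2Space : T2Space X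
  polynormableSpace : PolynormableSpace 𝕜 X

/-- `τ` makes `X` a complete barrelled locally convex Hausdorff space. -/
structure IsCompleteBarrelled (𝕜 : Type v) [RCLike 𝕜] {X : Type u} [AddCommGroup X] [Module 𝕜 X]
    (τ : TopologicalSpace X) : Prop extends IsLCHausdorff 𝕜 τ where
  barrelledSpace : BarrelledSpace 𝕜 X
  completeSpace : @CompleteSpace X (IsTopologicalAddGroup.rightUniformSpace X)

/-- The family `ℬ` of all `τ`-bounded subsets of `X`. -/
def boundedSets (𝕜 : Type v) [RCLike 𝕜] {X : Type u} [AddCommGroup X] [Module 𝕜 X]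
    (τ : TopologicalSpace X) : Set (Set X) :=
  {B | Bornology.IsVonNBounded 𝕜 B}

/-- `(X, τ)` is bornological: every absolutely convex set that absorbs all bounded sets is a
neighbourhood of `0`. -/
def IsBornological (𝕜 : Type v) [RCLike 𝕜] {X : Type u} [AddCommGroup X] [Module 𝕜 X]
    (τ : TopologicalSpace X) : Prop :=
  ∀ U : Set X, AbsConvex 𝕜 U → (∀ B ∈ boundedSets 𝕜 τ, Absorbs 𝕜 U B) → U ∈ 𝓝 (0 : X)

/-- `(X, τ)` is a BC-space: every linear map with closed graph from a Banach space to `X` is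
continuous. -/
def IsBCSpace (𝕜 : Type v) [RCLike 𝕜] {X : Type u} [AddCommGroup X] [Module 𝕜 X]
    (τ : TopologicalSpace X) : Prop :=
  ∀ (E : Type u) [NormedAddCommGroup E] [NormedSpace 𝕜 E] [CompleteSpace E] (g : E →ₗ[𝕜] X),
    IsClosed {p : E × X | p.2 = g p.1} → Continuous g

/-- Condition (BBC) for `τ'`: every `τ`-bounded set is contained in an absolutely convex
`τ`-bounded `τ'`-compact set. -/
def BBC (𝕜 : Type v) [RCLike 𝕜] {X : Type u} [AddCommGroup X] [Module 𝕜 X]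
    (τ τ' : TopologicalSpace X) : Prop :=
  ∀ B ∈ boundedSets 𝕜 τ, ∃ K ∈ boundedSets 𝕜 τ,
    AbsConvex 𝕜 K ∧ @IsCompact X τ' K ∧ B ⊆ K

/-- Condition (CNC) for `τ'`: `τ` has a basis of neighbourhoods of `0` consisting of absolutely
convex `τ'`-closed sets. -/
def CNC (𝕜 : Type v) [RCLike 𝕜] {X : Type u} [AddCommGroup X] [Module 𝕜 X]
    (τ τ' : TopologicalSpace X) : Prop :=
  ∀ U ∈ @nhds X τ 0, ∃ V ∈ @nhds X τ 0, AbsConvex 𝕜 V ∧ IsClosed[τ'] V ∧ V ⊆ U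

/-- The linear functionals on `X` whose restriction to every `τ`-bounded set is
`τ'`-continuous, as a subspace of the algebraic dual of `X`. -/
def boundedDualSubmodule (𝕜 : Type v) [RCLike 𝕜] {X : Type u} [AddCommGroup X] [Module 𝕜 X]
    (τ τ' : TopologicalSpace X) : Submodule 𝕜 (Module.Dual 𝕜 X) where
  carrier := {l | ∀ B ∈ boundedSets 𝕜 τ, @ContinuousOn X 𝕜 τ' _ l B}
  add_mem' {l m} hl hm := fun B hB =>
    @ContinuousOn.add 𝕜 _ _ _ X τ' l m B (hl B hB) (hm B hB)
  zero_mem' := fun B _ => @continuousOn_const X 𝕜 τ' _ B 0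
  smul_mem' c l hl := fun B hB =>
    @ContinuousOn.const_smul 𝕜 𝕜 X _ _ _ τ' l B (hl B hB) c

/-- The space `X'_{ℬ,τ'}`. -/
def BoundedDual (𝕜 : Type v) [RCLike 𝕜] {X : Type u} [AddCommGroup X] [Module 𝕜 X]
    (τ τ' : TopologicalSpace X) : Type (max u v) :=
  boundedDualSubmodule 𝕜 τ τ'

noncomputable instance (𝕜 : Type v) [RCLike 𝕜] {X : Type u} [AddCommGroup X] [Module 𝕜 X]
    (τ τ' : TopologicalSpace X) : AddCommGroup (BoundedDual 𝕜 τ τ') :=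
  inferInstanceAs (AddCommGroup (boundedDualSubmodule 𝕜 τ τ'))

noncomputable instance (𝕜 : Type v) [RCLike 𝕜] {X : Type u} [AddCommGroup X] [Module 𝕜 X]
    (τ τ' : TopologicalSpace X) : Module 𝕜 (BoundedDual 𝕜 τ τ') :=
  inferInstanceAs (Module 𝕜 (boundedDualSubmodule 𝕜 τ τ'))

/-- The topology `β` of uniform convergence on the `τ`-bounded subsets of `X`. -/
instance (𝕜 : Type v) [RCLike 𝕜] {X : Type u} [AddCommGroup X] [Module 𝕜 X]
    (τ τ' : TopologicalSpace X) : TopologicalSpace (BoundedDual 𝕜 τ τ') :=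
  TopologicalSpace.induced
    (fun l : boundedDualSubmodule 𝕜 τ τ' =>
      UniformOnFun.ofFun (boundedSets 𝕜 τ) (fun x : X => l.1 x))
    (UniformOnFun.topologicalSpace X 𝕜 (boundedSets 𝕜 τ))

/-- A class of (topological vector) spaces over `𝕜`. -/
abbrev SpaceClass (𝕜 : Type v) [RCLike 𝕜] :=
  ∀ (Z : Type u) [AddCommGroup Z] [Module 𝕜 Z] [TopologicalSpace Z], Prop

/-- The class `C` is closed under topological isomorphisms. -/
def SpaceClass.ClosedUnderIso {𝕜 : Type v} [RCLike 𝕜] (C : SpaceClass.{u} 𝕜) : Prop :=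
  ∀ (Y Z : Type u) [AddCommGroup Y] [Module 𝕜 Y] [TopologicalSpace Y]
    [AddCommGroup Z] [Module 𝕜 Z] [TopologicalSpace Z],
    C Y → Nonempty (Y ≃L[𝕜] Z) → C Z

/-- The class `C` consists of complete barrelled locally convex Hausdorff spaces. -/
def SpaceClass.CompleteBarrelled {𝕜 : Type v} [RCLike 𝕜] (C : SpaceClass.{u} 𝕜) : Prop :=
  ∀ (Z : Type u) [AddCommGroup Z] [Module 𝕜 Z] [τZ : TopologicalSpace Z],
    C Z → IsCompleteBarrelled 𝕜 τZ

/-- For a locally convex Hausdorff space `Z`, the topological isomorphisms `φ : (X, τ) → Z'_b`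
onto the strong dual of `Z`; the pairs `(Z, φ)` are the preduals of `(X, τ)`.  (The topology
Mathlib puts on `StrongDual 𝕜 Z` is uniform convergence on bounded sets.) -/
abbrev PredualMap (𝕜 : Type v) [RCLike 𝕜] {X : Type u} [AddCommGroup X] [Module 𝕜 X]
    (τ : TopologicalSpace X) (Z : Type u) [AddCommGroup Z] [Module 𝕜 Z] [TopologicalSpace Z] :=
  X ≃L[𝕜] StrongDual 𝕜 Z

/-- `(X, τ)` is a dual space. -/
def IsDualSpace (𝕜 : Type v) [RCLike 𝕜] {X : Type u} [AddCommGroup X] [Module 𝕜 X]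
    (τ : TopologicalSpace X) : Prop :=
  ∃ (Y : Type u) (_ : AddCommGroup Y) (_ : Module 𝕜 Y) (τY : TopologicalSpace Y),
    IsLCHausdorff 𝕜 τY ∧ Nonempty (PredualMap 𝕜 τ Y)

/-- The dual space `(X, τ)` has a strongly unique `C` predual: for all preduals `(Y, φ)`, `(Z, ψ)`
with `Y`, `Z` in `C`, every topological isomorphism `α : Z'_b → Y'_b` is the transpose of a
topological isomorphism `Y → Z`. -/
def HasStronglyUniquePredual (𝕜 : Type v) [RCLike 𝕜] {X : Type u} [AddCommGroup X] [Module 𝕜 X]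
    (τ : TopologicalSpace X) (C : SpaceClass.{u} 𝕜) : Prop :=
  IsDualSpace 𝕜 τ ∧
  ∀ (Y Z : Type u) [AddCommGroup Y] [Module 𝕜 Y] [TopologicalSpace Y]
    [AddCommGroup Z] [Module 𝕜 Z] [TopologicalSpace Z],
    C Y → C Z → PredualMap 𝕜 τ Y → PredualMap 𝕜 τ Z →
    ∀ α : StrongDual 𝕜 Z ≃L[𝕜] StrongDual 𝕜 Y,
      ∃ lam : Y ≃L[𝕜] Z, ∀ z' : StrongDual 𝕜 Z, α z' = z'.comp (lam : Y →L[𝕜] Z)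

/-- The topology `τ_p` of pointwise convergence on a space `F` of functions. -/
@[reducible] def pointwiseTopology {𝕜 : Type v} [RCLike 𝕜] {Ω : Type u} (F : Submodule 𝕜 (Ω → 𝕜)) :
    TopologicalSpace F :=
  TopologicalSpace.induced (fun f : F => (f : Ω → 𝕜)) Pi.topologicalSpace

/-! A complete barrelled predual `Z` is determined inside the functions on `F` by the functions `f ↦
φ f z`. With uniform convergence on bounded sets, `z ↦ (f ↦ φ f z)` is a closed embedding
(`isClosedEmbedding_predualEmbedding`). If the `z_x` of (b) exist, a functional vanishing on all of
them is `φ f` with `f = 0`, so by Hahn–Banach they span a dense subspace. The image of `Z` is then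
the closed span of the point evaluations, whatever `Z` is. Two such preduals are therefore
identified compatibly with their pairings (`exists_equiv_of_preduals`); transporting the predual map
along `α` turns this into strong uniqueness.

Conversely, evaluation makes `F'_{ℬ,τ'}` itself a predual (`BoundedDual.exists_equiv_strongDual`),
and it contains every point evaluation `δ_x`. Strong uniqueness gives an isomorphism onto `Z`, and
the image of `δ_x` is `z_x`. Uniqueness of `z_x` holds because `Z'` separates the points of `Z`. -/

/-! ### Hahn–Banach separation for absolutely convex sets. -/

section Separation

theorem Submodule.absConvex {𝕜 : Type*} [RCLike 𝕜] {E : Type*} [AddCommGroup E] [Module 𝕜 E]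
    (S : Submodule 𝕜 E) : AbsConvex 𝕜 (S : Set E) :=
  ⟨balanced_iff_smul_mem.2 fun _ _ _ hx => S.smul_mem _ hx, S.convex⟩

variable {𝕜 : Type*} [RCLike 𝕜] {E : Type*} [AddCommGroup E] [Module 𝕜 E] [TopologicalSpace E]

theorem AbsConvex.image {𝕜 : Type*} [RCLike 𝕜] {E F : Type*} [AddCommGroup E] [Module 𝕜 E]
    [AddCommGroup F] [Module 𝕜 F] {s : Set E} (hs : AbsConvex 𝕜 s) (f : E →ₗ[𝕜] F) :
    AbsConvex 𝕜 (f '' s) := by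
  refine ⟨balanced_iff_smul_mem.2 ?_, hs.2.linear_image f⟩
  rintro c hc _ ⟨x, hx, rfl⟩
  exact ⟨c • x, hs.1.smul_mem hc hx, map_smul f c x⟩

theorem Seminorm.absConvex_closedBall_zero {𝕜 : Type*} [RCLike 𝕜] {E : Type*} [AddCommGroup E]
    [Module 𝕜 E] (p : Seminorm 𝕜 E) (r : ℝ) : AbsConvex 𝕜 (p.closedBall 0 r) := by
  refine ⟨p.balanced_closedBall_zero _, ?_⟩
  intro a ha b hb c d hc hd hcd
  rw [Seminorm.mem_closedBall_zero] at *
  have hcd' : ‖c‖ + ‖d‖ = 1 := by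
    have := congrArg RCLike.re hcd
    rwa [map_add, RCLike.one_re, ← RCLike.norm_of_nonneg' hc, ← RCLike.norm_of_nonneg' hd,
      RCLike.ofReal_re, RCLike.ofReal_re] at this
  calc p (c • a + d • b) ≤ ‖c‖ * p a + ‖d‖ * p b := by
        simpa [map_smul_eq_mul] using map_add_le_add p (c • a) (d • b)
    _ ≤ ‖c‖ * r + ‖d‖ * r := by gcongr
    _ = r := by rw [← add_mul, hcd', one_mul]

theorem AbsConvex.exists_dual_norm_le_one_of_notMem [PolynormableSpace 𝕜 E] {s : Set E} {x : E}
    (hs : AbsConvex 𝕜 s) (h0 : (0 : E) ∈ s) (hc : IsClosed s) (hx : x ∉ s) :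
    ∃ f : StrongDual 𝕜 E, (∀ a ∈ s, ‖f a‖ ≤ 1) ∧ 1 < ‖f x‖ := by
  let : Module ℝ E := .restrictScalars ℝ 𝕜 E
  have : IsScalarTower ℝ 𝕜 E := .restrictScalars ℝ 𝕜 E
  have hsem := PolynormableSpace.withSeminorms 𝕜 E
  have : LocallyConvexSpace ℝ E := hsem.toLocallyConvexSpace
  have : IsTopologicalAddGroup E := hsem.topologicalAddGroup
  have : ContinuousSMul 𝕜 E := hsem.continuousSMul
  obtain ⟨f, r, hfs, hfx⟩ :=
    RCLike.geometric_hahn_banach_closed_point (𝕜 := 𝕜) (hs.2.lift ℝ) hc hx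
  have hr : 0 < r := by simpa using hfs 0 h0
  have hrk : ‖((r : 𝕜)⁻¹)‖ = r⁻¹ := by simp [abs_of_pos hr]
  refine ⟨(r : 𝕜)⁻¹ • f, fun a ha => ?_, ?_⟩
  -- Hahn–Banach only bounds the real part; since `s` is balanced, rotating `a` makes the value of
  -- `f` equal to its norm.
  · obtain ⟨c, hc1, hca⟩ := RCLike.exists_norm_eq_mul_self (f a)
    have hmem : c • a ∈ s := hs.1.smul_mem hc1.le ha
    have := hfs _ hmem
    rw [map_smul, smul_eq_mul, ← hca, RCLike.ofReal_re] at this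
    rw [smul_apply, norm_smul, hrk, inv_mul_le_iff₀ hr, mul_one]
    exact this.le
  · rw [smul_apply, norm_smul, hrk, lt_inv_mul_iff₀ hr, mul_one]
    exact hfx.trans_le (RCLike.re_le_norm _)

theorem Submodule.mem_topologicalClosure_of_forall_dual [PolynormableSpace 𝕜 E]
    [ContinuousAdd E] [ContinuousConstSMul 𝕜 E] (S : Submodule 𝕜 E) {x : E}
    (h : ∀ f : StrongDual 𝕜 E, (∀ y ∈ S, f y = 0) → f x = 0) : x ∈ S.topologicalClosure := by
  by_contra hx
  obtain ⟨f, hf, hfx⟩ := AbsConvex.exists_dual_norm_le_one_of_notMem (𝕜 := 𝕜)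
    (s := (S.topologicalClosure : Set E))
    S.topologicalClosure.absConvex
    S.topologicalClosure.zero_mem S.isClosed_topologicalClosure hx
  have hzero : ∀ y ∈ S, f y = 0 := by
    intro y hy
    by_contra hne
    -- A functional bounded by 1 on a subspace vanishes there: this multiple of `y` would have value
    -- 2.
    have := hf (((2 : 𝕜) * (f y)⁻¹) • y) (S.le_topologicalClosure (S.smul_mem _ hy))
    rw [map_smul, smul_eq_mul, mul_assoc, inv_mul_cancel₀ hne] at this
    norm_num at this
  rw [h f hzero] at hfx
  norm_num at hfx

theorem PolynormableSpace.exists_dual_ne_zero [PolynormableSpace 𝕜 E] [T1Space E] {x : E}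
    (hx : x ≠ 0) : ∃ f : StrongDual 𝕜 E, f x ≠ 0 := by
  obtain ⟨f, -, hf⟩ := AbsConvex.exists_dual_norm_le_one_of_notMem (𝕜 := 𝕜) (s := ({0} : Set E))
    (by simpa using (⊥ : Submodule 𝕜 E).absConvex) rfl isClosed_singleton hx
  exact ⟨f, fun h => by norm_num [h] at hf⟩

theorem PolynormableSpace.exists_absConvex_isClosed_mem_nhds [PolynormableSpace 𝕜 E] {U : Set E}
    (hU : U ∈ 𝓝 (0 : E)) : ∃ V ∈ 𝓝 (0 : E), AbsConvex 𝕜 V ∧ IsClosed V ∧ V ⊆ U := by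
  have hsem := PolynormableSpace.withSeminorms 𝕜 E
  have : IsTopologicalAddGroup E := hsem.topologicalAddGroup
  obtain ⟨⟨I, r⟩, hr, hIr⟩ := hsem.hasBasis_ball.mem_iff.1 hU
  set p : Seminorm 𝕜 E := I.sup (fun p : {p : Seminorm 𝕜 E // Continuous p} => p.1) with hp
  have hpc : Continuous p := Seminorm.continuous_finsetSup fun i _ => i.2
  have hset : p.closedBall 0 (r / 2) = p ⁻¹' Set.Iic (r / 2) := by
    ext y; simp [Seminorm.mem_closedBall]
  refine ⟨p.closedBall 0 (r / 2), ?_, p.absConvex_closedBall_zero _, ?_, ?_⟩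
  · rw [hset]
    exact hpc.continuousAt.preimage_mem_nhds (by simpa using Iic_mem_nhds (half_pos hr))
  · rw [hset]; exact isClosed_Iic.preimage hpc
  · refine subset_trans (fun y hy => ?_) hIr
    rw [Seminorm.mem_closedBall_zero] at hy
    rw [Seminorm.mem_ball_zero]
    exact hy.trans_lt (half_lt_self hr)

end Separation

/-! ### Uniform convergence on bounded sets. -/

section BoundedSets

variable {𝕜 : Type*} [RCLike 𝕜] {X : Type*} [AddCommGroup X] [Module 𝕜 X]

theorem boundedSets_nonempty (τ : TopologicalSpace X) : (boundedSets 𝕜 τ).Nonempty :=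
  ⟨∅, Bornology.isVonNBounded_empty 𝕜 X⟩

theorem directedOn_boundedSets (τ : TopologicalSpace X) :
    DirectedOn (· ⊆ ·) (boundedSets 𝕜 τ) := fun s hs t ht =>
  ⟨s ∪ t, Bornology.IsVonNBounded.union hs ht, Set.subset_union_left, Set.subset_union_right⟩

theorem singleton_mem_boundedSets {τ : TopologicalSpace X} [ContinuousSMul 𝕜 X] (x : X) :
    {x} ∈ boundedSets 𝕜 τ :=
  Bornology.isVonNBounded_singleton x

theorem hasBasis_nhds_zero_uniformOnFun_boundedSets (τ : TopologicalSpace X) :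
    (𝓝 (0 : UniformOnFun X 𝕜 (boundedSets 𝕜 τ))).HasBasis
      (fun p : Set X × ℝ => p.1 ∈ boundedSets 𝕜 τ ∧ 0 < p.2)
      fun p => {g | ∀ x ∈ p.1, ‖UniformOnFun.toFun _ g x‖ < p.2} := by
  simpa using UniformOnFun.hasBasis_nhds_zero_of_basis (boundedSets 𝕜 τ)
    (boundedSets_nonempty τ) (directedOn_boundedSets τ) (Metric.nhds_basis_ball (x := (0 : 𝕜)))

theorem t2Space_uniformOnFun_boundedSets {τ : TopologicalSpace X} [ContinuousSMul 𝕜 X] :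
    T2Space (UniformOnFun X 𝕜 (boundedSets 𝕜 τ)) :=
  UniformOnFun.t2Space_of_covering <| Set.eq_univ_of_forall fun x =>
    ⟨{x}, singleton_mem_boundedSets x, rfl⟩

end BoundedSets

/-! ### A predual as a closed subspace of the functions on `X`. -/

section PredualEmbedding

variable {𝕜 : Type*} [RCLike 𝕜] {X : Type*} [AddCommGroup X] [Module 𝕜 X] [τ : TopologicalSpace X]
  {Z : Type*} [AddCommGroup Z] [Module 𝕜 Z] [τZ : TopologicalSpace Z]

/-- For a linear topological isomorphism `φ : X → Z'`, the map `Z → 𝕜^X`, `z ↦ (f ↦ φ f z)`, into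
the functions on `X` with the topology of uniform convergence on bounded sets. -/
def predualEmbedding (φ : X ≃L[𝕜] StrongDual 𝕜 Z) :
    Z →ₗ[𝕜] UniformOnFun X 𝕜 (boundedSets 𝕜 τ) where
  toFun z := UniformOnFun.ofFun _ fun f => φ f z
  map_add' z w := funext fun f => map_add (φ f) z w
  map_smul' c z := funext fun f => map_smul (φ f) c z

@[simp]
theorem toFun_predualEmbedding (φ : X ≃L[𝕜] StrongDual 𝕜 Z) (z : Z) (f : X) :
    UniformOnFun.toFun _ (predualEmbedding φ z) f = φ f z :=
  rfl

theorem predualEmbedding_eq_iff {Y : Type*} [AddCommGroup Y] [Module 𝕜 Y] [TopologicalSpace Y]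
    {φ : X ≃L[𝕜] StrongDual 𝕜 Y} {ψ : X ≃L[𝕜] StrongDual 𝕜 Z} {y : Y} {z : Z} :
    predualEmbedding ψ z = predualEmbedding φ y ↔ ∀ f, ψ f z = φ f y :=
  funext_iff

theorem predualEmbedding_injective [PolynormableSpace 𝕜 Z] [T1Space Z]
    (φ : X ≃L[𝕜] StrongDual 𝕜 Z) : Function.Injective (predualEmbedding φ) := by
  refine (injective_iff_map_eq_zero _).2 fun z hz => ?_
  by_contra hne
  obtain ⟨f, hf⟩ := PolynormableSpace.exists_dual_ne_zero (𝕜 := 𝕜) hne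
  apply hf
  have : φ (φ.symm f) z = 0 := congrFun hz (φ.symm f)
  simpa using this

/-- Continuity is Banach–Steinhaus: `Z` is barrelled, so bounded subsets of `Z'` are equicontinuous.
Conversely, a closed absolutely convex neighbourhood `V` equals its bipolar, and its polar `M` is
strongly bounded, so being small on `φ.symm '' M` forces `z ∈ V`. -/
theorem isInducing_predualEmbedding [IsTopologicalAddGroup Z] [ContinuousSMul 𝕜 Z]
    [PolynormableSpace 𝕜 Z] [BarrelledSpace 𝕜 Z] (φ : X ≃L[𝕜] StrongDual 𝕜 Z) :
    Topology.IsInducing (predualEmbedding φ) := by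
  have hE := hasBasis_nhds_zero_uniformOnFun_boundedSets (𝕜 := 𝕜) τ
  refine ⟨IsTopologicalAddGroup.ext inferInstance (topologicalAddGroup_induced _) ?_⟩
  rw [nhds_induced, map_zero]
  refine le_antisymm ?_ fun U hU => ?_
  · rw [← Filter.tendsto_iff_comap, hE.tendsto_right_iff]
    rintro ⟨B, ε⟩ ⟨hB, hε⟩
    let : UniformSpace Z := IsTopologicalAddGroup.rightUniformSpace Z
    have : IsUniformAddGroup Z := isUniformAddGroup_of_addCommGroup
    have hφB := (show Bornology.IsVonNBounded 𝕜 B from hB).image (φ : X →L[𝕜] StrongDual 𝕜 Z)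
    have hequi : UniformEquicontinuous ((↑) ∘ fun f : B => (φ f : Z →L[𝕜] 𝕜)) := by
      refine PolynormableSpace.banach_steinhaus fun z => ?_
      have := ContinuousLinearMap.isVonNBounded_iff.1 hφB {z}
        (Bornology.isVonNBounded_singleton z)
      refine this.subset ?_
      rintro _ ⟨f, rfl⟩
      exact ⟨φ f, ⟨f, f.2, rfl⟩, z, rfl, rfl⟩
    have := Metric.equicontinuousAt_iff_right.1 (hequi.equicontinuous 0) ε hε
    filter_upwards [this] with z hz f hf
    simpa using hz ⟨f, hf⟩
  · obtain ⟨V, hV, hVabs, hVc, hVU⟩ :=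
      PolynormableSpace.exists_absConvex_isClosed_mem_nhds (𝕜 := 𝕜) hU
    set M : Set (StrongDual 𝕜 Z) := {f | ∀ z ∈ V, ‖f z‖ ≤ 1} with hM
    have hMb : Bornology.IsVonNBounded 𝕜 M := by
      refine ContinuousLinearMap.isVonNBounded_iff.2 fun s hs => ?_
      obtain ⟨r, hr, hrs⟩ := (hs hV).exists_pos
      rw [NormedSpace.isVonNBounded_iff, isBounded_iff_forall_norm_le]
      refine ⟨r, ?_⟩
      rintro _ ⟨f, hf, z, hz, rfl⟩
      obtain ⟨w, hw, rfl⟩ := hrs (r : 𝕜) (by simp [abs_of_pos hr]) hz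
      simpa [abs_of_pos hr] using mul_le_mul_of_nonneg_left (hf w hw) hr.le
    have hB : φ.symm '' M ∈ boundedSets 𝕜 τ :=
      hMb.image (φ.symm : StrongDual 𝕜 Z →L[𝕜] X)
    refine Filter.mem_comap.2 ⟨_, hE.mem_of_mem (i := (φ.symm '' M, 1)) ⟨hB, one_pos⟩, ?_⟩
    intro z hz
    apply hVU
    by_contra hzV
    obtain ⟨f, hf, hfz⟩ :=
      hVabs.exists_dual_norm_le_one_of_notMem (mem_of_mem_nhds hV) hVc hzV
    have := hz (φ.symm f) ⟨f, hf, rfl⟩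
    rw [toFun_predualEmbedding, ContinuousLinearEquiv.apply_symm_apply] at this
    exact this.not_gt hfz

/-- Completeness of `Z` makes the range complete, hence closed. -/
theorem isClosedEmbedding_predualEmbedding [ContinuousSMul 𝕜 X]
    (hZ : IsCompleteBarrelled 𝕜 τZ)
    (φ : X ≃L[𝕜] StrongDual 𝕜 Z) : Topology.IsClosedEmbedding (predualEmbedding φ) := by
  have := hZ.isTopologicalAddGroup
  have := hZ.continuousSMul
  have := hZ.t2Space
  have := hZ.polynormableSpace
  have := hZ.barrelledSpace
  have hind := isInducing_predualEmbedding φ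
  refine ⟨⟨hind, predualEmbedding_injective φ⟩, ?_⟩
  let : UniformSpace Z := IsTopologicalAddGroup.rightUniformSpace Z
  have : IsUniformAddGroup Z := isUniformAddGroup_of_addCommGroup
  have : CompleteSpace Z := hZ.completeSpace
  have : T2Space (UniformOnFun X 𝕜 (boundedSets 𝕜 τ)) := t2Space_uniformOnFun_boundedSets
  exact (AddMonoidHom.isUniformInducing_of_isInducing hind).isComplete_range.isClosed

/-- If every `f ∈ X` vanishing at all `z i` is zero, then the range of the embedding is determined
by the functions represented by the `z i`. -/
theorem range_predualEmbedding [ContinuousSMul 𝕜 X]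
    (hZ : IsCompleteBarrelled 𝕜 τZ)
    (φ : X ≃L[𝕜] StrongDual 𝕜 Z) {ι : Type*} (z : ι → Z)
    (hz : ∀ f, (∀ i, φ f (z i) = 0) → f = 0) :
    Set.range (predualEmbedding φ) =
      closure (Submodule.span 𝕜 (Set.range fun i => predualEmbedding φ (z i)) :
        Set (UniformOnFun X 𝕜 (boundedSets 𝕜 τ))) := by
  have := hZ.isTopologicalAddGroup
  have := hZ.continuousSMul
  have := hZ.polynormableSpace
  have hdense : (Submodule.span 𝕜 (Set.range z)).topologicalClosure = ⊤ := by
    refine eq_top_iff.2 fun x _ => Submodule.mem_topologicalClosure_of_forall_dual _ fun f hf => ?_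
    have : φ.symm f = 0 := hz _ fun i => by
      simpa using hf (z i) (Submodule.subset_span ⟨i, rfl⟩)
    simp [(map_eq_zero_iff _ φ.symm.injective).1 this]
  have h1 : (Submodule.span 𝕜 (Set.range fun i => predualEmbedding φ (z i)) :
      Set (UniformOnFun X 𝕜 (boundedSets 𝕜 τ))) =
      predualEmbedding φ '' (Submodule.span 𝕜 (Set.range z) : Set Z) := by
    rw [← Submodule.map_coe, Submodule.map_span, ← Set.range_comp]
    rfl
  rw [h1, (isClosedEmbedding_predualEmbedding hZ φ).closure_image_eq,
    ← Submodule.topologicalClosure_coe, hdense, Submodule.top_coe, Set.image_univ]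

/-- Both embeddings have as range the closed span of the same functions, so one can be composed with
the inverse of the other. -/
theorem exists_equiv_of_preduals [ContinuousSMul 𝕜 X]
    {Y : Type*} [AddCommGroup Y] [Module 𝕜 Y] {τY : TopologicalSpace Y}
    (hY : IsCompleteBarrelled 𝕜 τY) (hZ : IsCompleteBarrelled 𝕜 τZ)
    (φ : X ≃L[𝕜] StrongDual 𝕜 Y) (ψ : X ≃L[𝕜] StrongDual 𝕜 Z) {ι : Type*} (y : ι → Y) (z : ι → Z)
    (hyz : ∀ f i, ψ f (z i) = φ f (y i)) (hsep : ∀ f, (∀ i, φ f (y i) = 0) → f = 0) :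
    ∃ e : Y ≃L[𝕜] Z, ∀ f w, ψ f (e w) = φ f w := by
  have hφ := isClosedEmbedding_predualEmbedding hY φ
  have hψ := isClosedEmbedding_predualEmbedding hZ ψ
  have hrange : Set.range (predualEmbedding φ) = Set.range (predualEmbedding ψ) := by
    rw [range_predualEmbedding hY φ y hsep,
      range_predualEmbedding hZ ψ z fun f hf => hsep f fun i => by rw [← hyz, hf]]
    have : ∀ i, predualEmbedding ψ (z i) = predualEmbedding φ (y i) := fun i =>
      predualEmbedding_eq_iff.2 fun f => hyz f i
    simp only [this]
  have hto : ∀ w : Y, ∃ v : Z, predualEmbedding ψ v = predualEmbedding φ w := fun w =>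
    hrange.subset (Set.mem_range_self w)
  have hinv : ∀ v : Z, ∃ w : Y, predualEmbedding φ w = predualEmbedding ψ v := fun v =>
    hrange.symm.subset (Set.mem_range_self v)
  choose e he using hto
  choose e' he' using hinv
  refine ⟨{ toFun := e
            invFun := e'
            map_add' := fun a b => hψ.injective (by simp [he])
            map_smul' := fun c a => hψ.injective (by simp [he])
            left_inv := fun a => hφ.injective (by rw [he', he])
            right_inv := fun a => hψ.injective (by rw [he, he'])
            continuous_toFun := ?_
            continuous_invFun := ?_ }, fun f w => predualEmbedding_eq_iff.1 (he w) f⟩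
  · refine hψ.isInducing.continuous_iff.2 ?_
    rw [show predualEmbedding ψ ∘ e = predualEmbedding φ from funext he]
    exact hφ.continuous
  · refine hφ.isInducing.continuous_iff.2 ?_
    rw [show predualEmbedding φ ∘ e' = predualEmbedding ψ from funext he']
    exact hψ.continuous

end PredualEmbedding

/-! ### Weak topologies of a pairing. -/

section WeakBilin

variable {𝕜 : Type*} [RCLike 𝕜] {E F : Type*} [AddCommGroup E] [Module 𝕜 E] [AddCommGroup F]
  [Module 𝕜 F] {P : E →ₗ[𝕜] F →ₗ[𝕜] 𝕜}

theorem WeakBilin.continuousOn_of_continuousOn_eval {α : Type*} {tα : TopologicalSpace α}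
    (P : E →ₗ[𝕜] F →ₗ[𝕜] 𝕜) {g : α → WeakBilin P} {s : Set α}
    (h : ∀ y, ContinuousOn (fun a => P (g a) y) s) : ContinuousOn g s := by
  rw [continuousOn_iff_continuous_domRestrict]
  exact WeakBilin.continuous_of_continuous_eval P fun y =>
    continuousOn_iff_continuous_domRestrict.1 (h y)

/-- The separating functional is weakly continuous, hence given by pairing with an element of `F`.
-/
theorem WeakBilin.exists_norm_le_one_of_notMem (hP : Function.Injective P) {s : Set (WeakBilin P)}
    (hs : AbsConvex 𝕜 s) (h0 : 0 ∈ s) (hsc : IsCompact s) {x : WeakBilin P} (hx : x ∉ s) :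
    ∃ y : F, (∀ a ∈ s, ‖P a y‖ ≤ 1) ∧ 1 < ‖P x y‖ := by
  have : T2Space (WeakBilin P) := (WeakBilin.isEmbedding hP).t2Space
  have : PolynormableSpace 𝕜 (WeakBilin P) :=
    (LinearMap.weakBilin_withSeminorms P).toPolynormableSpace
  obtain ⟨f, hf, hfx⟩ := AbsConvex.exists_dual_norm_le_one_of_notMem hs h0 hsc.isClosed hx
  obtain ⟨y, rfl⟩ := LinearMap.dualEmbedding_surjective P f
  exact ⟨y, hf, hfx⟩

end WeakBilin

/-! ### The canonical predual `X'_{ℬ,τ'}`. -/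

namespace BoundedDual

variable {𝕜 : Type v} [RCLike 𝕜] {X : Type u} [AddCommGroup X] [Module 𝕜 X]
  {τ' τ : TopologicalSpace X}

/-- The inclusion of `X'_{ℬ,τ'}` into the algebraic dual of `X`. -/
def toDual (τ τ' : TopologicalSpace X) : BoundedDual 𝕜 τ τ' →ₗ[𝕜] Module.Dual 𝕜 X :=
  (boundedDualSubmodule 𝕜 τ τ').subtype

theorem continuousOn_toDual (l : BoundedDual 𝕜 τ τ') {B : Set X} (hB : B ∈ boundedSets 𝕜 τ) :
    @ContinuousOn X 𝕜 τ' _ (toDual τ τ' l) B :=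
  Subtype.property (p := (· ∈ boundedDualSubmodule 𝕜 τ τ')) l B hB

/-- The element of `X'_{ℬ,τ'}` given by a `τ'`-continuous linear functional. -/
def ofDual (τ τ' : TopologicalSpace X) (l : Module.Dual 𝕜 X) (hl : @Continuous X 𝕜 τ' _ l) :
    BoundedDual 𝕜 τ τ' :=
  (⟨l, fun _ _ => @Continuous.continuousOn X 𝕜 τ' _ _ _ hl⟩ : boundedDualSubmodule 𝕜 τ τ')

theorem hasBasis_nhds_zero : (𝓝 (0 : BoundedDual 𝕜 τ τ')).HasBasis
    (fun p : Set X × ℝ => p.1 ∈ boundedSets 𝕜 τ ∧ 0 < p.2)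
    fun p => {l | ∀ x ∈ p.1, ‖toDual τ τ' l x‖ < p.2} := by
  have hE := hasBasis_nhds_zero_uniformOnFun_boundedSets (𝕜 := 𝕜) τ
  rw [nhds_induced]
  exact hE.comap _

theorem isVonNBounded_iff {M : Set (BoundedDual 𝕜 τ τ')} :
    Bornology.IsVonNBounded 𝕜 M ↔
      ∀ B ∈ boundedSets 𝕜 τ, ∃ r : ℝ, ∀ l ∈ M, ∀ x ∈ B, ‖toDual τ τ' l x‖ ≤ r := by
  rw [hasBasis_nhds_zero.isVonNBounded_iff]
  refine ⟨fun h B hB => ?_, fun h => ?_⟩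
  · obtain ⟨r, hr, hM⟩ := (h (B, 1) ⟨hB, one_pos⟩).exists_pos
    refine ⟨r, fun l hl x hx => ?_⟩
    obtain ⟨m, hm, rfl⟩ := hM (r : 𝕜) (by simp [abs_of_pos hr]) hl
    have : ‖toDual τ τ' m x‖ < 1 := hm x hx
    rw [map_smul, LinearMap.smul_apply, norm_smul]
    simpa [abs_of_pos hr] using mul_le_mul_of_nonneg_left this.le hr.le
  · rintro ⟨B, ε⟩ ⟨hB, hε⟩
    obtain ⟨r, hr⟩ := h B hB
    -- The extra 1 makes `c` nonzero and the final inequality strict.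
    refine absorbs_iff_norm.2 ⟨(|r| + 1) / ε, fun c hc l hl => ?_⟩
    have hc0 : 0 < ‖c‖ := lt_of_lt_of_le (by positivity) hc
    refine ⟨c⁻¹ • l, fun x hx => ?_, smul_inv_smul₀ (norm_pos_iff.1 hc0) l⟩
    rw [map_smul, LinearMap.smul_apply, norm_smul, norm_inv, inv_mul_lt_iff₀ hc0]
    rw [div_le_iff₀ hε] at hc
    linarith [hr l hl x hx, le_abs_self r]

/-- Evaluation at `x ∈ X`, as a continuous linear functional on `X'_{ℬ,τ'}`. -/
noncomputable def eval (hτ : IsLCHausdorff 𝕜 τ) (τ' : TopologicalSpace X) :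
    X →ₗ[𝕜] StrongDual 𝕜 (BoundedDual 𝕜 τ τ') where
  toFun x :=
    { toLinearMap := (toDual τ τ').flip x
      cont := by
        have := hτ.continuousSMul
        exact (UniformOnFun.uniformContinuous_eval_of_mem 𝕜 _ (Set.mem_singleton x)
          (singleton_mem_boundedSets x)).continuous.comp continuous_induced_dom }
  map_add' x y := ContinuousLinearMap.ext fun l => map_add (toDual τ τ' l) x y
  map_smul' c x := ContinuousLinearMap.ext fun l => map_smul (toDual τ τ' l) c x

theorem exists_norm_le_one_of_notMem {τ' : TopologicalSpace X} (hτ' : IsLCHausdorff 𝕜 τ')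
    {V : Set X} (hV : AbsConvex 𝕜 V) (h0 : 0 ∈ V) (hc : IsClosed[τ'] V) {x : X} (hx : x ∉ V) :
    ∃ l : BoundedDual 𝕜 τ τ', (∀ a ∈ V, ‖toDual τ τ' l a‖ ≤ 1) ∧ 1 < ‖toDual τ τ' l x‖ := by
  have := hτ'.polynormableSpace
  obtain ⟨f, hf, hfx⟩ :=
    @AbsConvex.exists_dual_norm_le_one_of_notMem 𝕜 _ X _ _ τ' _ V x hV h0 hc hx
  exact ⟨ofDual τ τ' f.toLinearMap f.cont, hf, hfx⟩

theorem eval_injective (hτ : IsLCHausdorff 𝕜 τ) (hτ' : IsLCHausdorff 𝕜 τ') :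
    Function.Injective (eval hτ τ') := by
  refine (injective_iff_map_eq_zero _).2 fun x hx => ?_
  by_contra hne
  have hclosed := @isClosed_singleton X τ' (@T2Space.t1Space X τ' hτ'.t2Space) 0
  obtain ⟨l, -, hl⟩ := exists_norm_le_one_of_notMem (τ := τ) hτ' (V := {0})
    (by simpa using (⊥ : Submodule 𝕜 X).absConvex) rfl hclosed hne
  have h : toDual τ τ' l x = 0 := congrArg (fun u : StrongDual 𝕜 (BoundedDual 𝕜 τ τ') => u l) hx
  norm_num [h] at hl

/-- A Mackey–Arens argument. Elements of `X'_{ℬ,τ'}` are `τ'`-continuous on the bounded set `K`, so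
the image of `K` in the algebraic dual is weakly compact and thus equals its bipolar, to which `u`
belongs. -/
theorem exists_eval_eq_of_norm_le_one (hτ : IsLCHausdorff 𝕜 τ) {K : Set X}
    (hK : K ∈ boundedSets 𝕜 τ) (hKabs : AbsConvex 𝕜 K) (h0 : 0 ∈ K) (hKc : @IsCompact X τ' K)
    (u : StrongDual 𝕜 (BoundedDual 𝕜 τ τ'))
    (hu : ∀ l, (∀ x ∈ K, ‖toDual τ τ' l x‖ ≤ 1) → ‖u l‖ ≤ 1) : ∃ x ∈ K, eval hτ τ' x = u := by
  let P : Module.Dual 𝕜 (BoundedDual 𝕜 τ τ') →ₗ[𝕜] BoundedDual 𝕜 τ τ' →ₗ[𝕜] 𝕜 := LinearMap.id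
  let e : X →ₗ[𝕜] WeakBilin P := (toDual τ τ').flip
  let u' : WeakBilin P := u.toLinearMap
  have hcont : @ContinuousOn X (WeakBilin P) τ' _ e K :=
    WeakBilin.continuousOn_of_continuousOn_eval P fun l => continuousOn_toDual l hK
  have hcomp : IsCompact (e '' K) := @IsCompact.image_of_continuousOn X _ τ' _ _ _ hKc hcont
  have hmem : u' ∈ e '' K := by
    by_contra hnot
    obtain ⟨l, hl, hlu⟩ := WeakBilin.exists_norm_le_one_of_notMem Function.injective_id
      (hKabs.image e) ⟨0, h0, map_zero e⟩ hcomp hnot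
    exact hlu.not_ge (hu l fun x hx => hl (e x) ⟨x, hx, rfl⟩)
  obtain ⟨x, hx, hxu⟩ := hmem
  exact ⟨x, hx, ContinuousLinearMap.ext fun l => LinearMap.congr_fun hxu l⟩

theorem eval_surjective (hτ : IsLCHausdorff 𝕜 τ) (hBBC : BBC 𝕜 τ τ') :
    Function.Surjective (eval hτ τ') := by
  intro u
  have hu : (u : BoundedDual 𝕜 τ τ' → 𝕜) ⁻¹' Metric.ball 0 1 ∈ 𝓝 0 :=
    u.continuous.continuousAt.preimage_mem_nhds (by simpa using Metric.ball_mem_nhds 0 one_pos)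
  obtain ⟨⟨B, ε⟩, ⟨hB, hε⟩, hBε⟩ := hasBasis_nhds_zero.mem_iff.1 hu
  have := hτ.continuousSMul
  -- Adjoining 0 to `B` ensures `0 ∈ K`, since the empty set is also absolutely convex.
  obtain ⟨K, hK, hKabs, hKc, hBK⟩ :=
    hBBC _ (Bornology.IsVonNBounded.union hB (singleton_mem_boundedSets (𝕜 := 𝕜) (0 : X)))
  -- Scaling by `ε / 2` turns the bound `≤ 1` on `K` into the strict bound `< ε` on `B`.
  have hc : ‖((ε / 2 : ℝ) : 𝕜)‖ = ε / 2 := by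
    rw [RCLike.norm_ofReal, abs_of_pos (half_pos hε)]
  obtain ⟨x, -, hx⟩ := exists_eval_eq_of_norm_le_one hτ hK hKabs (hBK (Or.inr rfl)) hKc
    (((ε / 2 : ℝ) : 𝕜) • u) fun l hl => by
      have : ((ε / 2 : ℝ) : 𝕜) • l ∈ (u : BoundedDual 𝕜 τ τ' → 𝕜) ⁻¹' Metric.ball 0 1 := by
        refine hBε fun x hx => ?_
        rw [map_smul, LinearMap.smul_apply, norm_smul, hc]
        have := mul_le_mul_of_nonneg_left (hl x (hBK (Or.inl hx))) (half_pos hε).le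
        linarith
      rw [Set.mem_preimage, mem_ball_zero_iff, map_smul] at this
      exact this.le
  refine ⟨((ε / 2 : ℝ) : 𝕜)⁻¹ • x, ?_⟩
  rw [map_smul, hx, inv_smul_smul₀]
  rw [← norm_pos_iff, hc]
  exact half_pos hε

theorem hasBasis_nhds_zero_strongDual :
    (𝓝 (0 : StrongDual 𝕜 (BoundedDual 𝕜 τ τ'))).HasBasis
      (fun p : Set (BoundedDual 𝕜 τ τ') × ℝ => Bornology.IsVonNBounded 𝕜 p.1 ∧ 0 < p.2)
      fun p => {u | ∀ l ∈ p.1, ‖u l‖ ≤ p.2} := by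
  simpa using ContinuousLinearMap.hasBasis_nhds_zero_of_basis (𝕜₁ := 𝕜) (σ := RingHom.id 𝕜)
    (E := BoundedDual 𝕜 τ τ') (Metric.nhds_basis_closedBall (x := (0 : 𝕜)))

/-- The polar of a bounded `M` is absolutely convex and absorbs bounded sets, hence is a
neighbourhood of 0 in a bornological space. -/
theorem continuous_eval (hτ : IsLCHausdorff 𝕜 τ) (hborn : IsBornological 𝕜 τ) :
    Continuous[τ, _] (eval hτ τ') := by
  have := hτ.isTopologicalAddGroup
  refine continuous_of_continuousAt_zero (eval hτ τ') ?_
  rw [ContinuousAt, map_zero, hasBasis_nhds_zero_strongDual.tendsto_right_iff]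
  rintro ⟨M, ε⟩ ⟨hM, hε⟩
  refine hborn {x | ∀ l ∈ M, ‖toDual τ τ' l x‖ ≤ ε} ?_ fun B hB => ?_
  · have : {x | ∀ l ∈ M, ‖toDual τ τ' l x‖ ≤ ε} =
        ⋂ l ∈ M, (toDual τ τ' l).toSeminorm.closedBall 0 ε := by
      ext x; simp
    rw [this]
    exact AbsConvex.iInter₂ fun l _ => Seminorm.absConvex_closedBall_zero _ _
  · obtain ⟨r, hr⟩ := isVonNBounded_iff.1 hM B hB
    refine absorbs_iff_norm.2 ⟨(|r| + 1) / ε, fun c hc x hx => ?_⟩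
    have hc0 : 0 < ‖c‖ := lt_of_lt_of_le (by positivity) hc
    refine ⟨c⁻¹ • x, fun l hl => ?_, smul_inv_smul₀ (norm_pos_iff.1 hc0) x⟩
    rw [map_smul, norm_smul, norm_inv, inv_mul_le_iff₀ hc0]
    rw [div_le_iff₀ hε] at hc
    linarith [hr l hl x hx, le_abs_self r]

/-- Openness of evaluation onto its range: (CNC) provides a `τ'`-closed `V`, which equals its
bipolar, and the polar of `V` is bounded because `V` absorbs bounded sets. -/
theorem exists_setOf_norm_le_subset (hτ : IsLCHausdorff 𝕜 τ) (hτ' : IsLCHausdorff 𝕜 τ')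
    (hCNC : CNC 𝕜 τ τ') {U : Set X} (hU : U ∈ @nhds X τ 0) :
    ∃ W ∈ 𝓝 (0 : StrongDual 𝕜 (BoundedDual 𝕜 τ τ')), eval hτ τ' ⁻¹' W ⊆ U := by
  obtain ⟨V, hV, hVabs, hVc, hVU⟩ := hCNC U hU
  have h0 : 0 ∈ V := @mem_of_mem_nhds X τ _ _ hV
  refine ⟨_, hasBasis_nhds_zero_strongDual.mem_of_mem
    (i := ({l | ∀ x ∈ V, ‖toDual τ τ' l x‖ ≤ 1}, 1)) ⟨?_, one_pos⟩, fun x hx => hVU ?_⟩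
  · refine isVonNBounded_iff.2 fun B hB => ?_
    obtain ⟨r, hr, hrB⟩ := Absorbs.exists_pos (hB hV)
    refine ⟨r, fun l hl x hx => ?_⟩
    obtain ⟨w, hw, rfl⟩ := hrB (r : 𝕜) (by simp [abs_of_pos hr]) hx
    rw [map_smul, norm_smul]
    simpa [abs_of_pos hr] using mul_le_mul_of_nonneg_left (hl w hw) hr.le
  · by_contra hxV
    obtain ⟨l, hl, hlx⟩ := exists_norm_le_one_of_notMem (τ := τ) hτ' hVabs h0 hVc hxV
    exact hlx.not_ge (hx l hl)

/-- `(X, τ)` is canonically the strong dual of `X'_{ℬ,τ'}`. -/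
theorem exists_equiv_strongDual (hτ : IsLCHausdorff 𝕜 τ) (hborn : IsBornological 𝕜 τ)
    (hτ' : IsLCHausdorff 𝕜 τ') (hBBC : BBC 𝕜 τ τ') (hCNC : CNC 𝕜 τ τ') :
    ∃ J : @ContinuousLinearEquiv 𝕜 𝕜 _ _ (RingHom.id 𝕜) (RingHom.id 𝕜) _ _ X τ _
        (StrongDual 𝕜 (BoundedDual 𝕜 τ τ')) _ _ _ _,
      ∀ x l, J x l = toDual τ τ' l x := by
  let e := LinearEquiv.ofBijective (eval hτ τ') ⟨eval_injective hτ hτ', eval_surjective hτ hBBC⟩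
  have := hτ.isTopologicalAddGroup
  have hsymm : ContinuousAt e.symm 0 := by
    rw [ContinuousAt, map_zero]
    intro U hU
    obtain ⟨W, hW, hWU⟩ := exists_setOf_norm_le_subset hτ hτ' hCNC hU
    refine Filter.mem_map.2 <| Filter.mem_of_superset hW fun u hu => hWU ?_
    rw [Set.mem_preimage]
    rwa [show eval hτ τ' (e.symm u) = u from e.apply_symm_apply u]
  exact ⟨{ e with
    continuous_toFun := continuous_eval hτ hborn
    continuous_invFun := continuous_of_continuousAt_zero e.symm hsymm }, fun _ _ => rfl⟩

end BoundedDual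

/-! ### Function spaces: point evaluations and the two implications. -/

section Preduals

variable {𝕜 : Type} [RCLike 𝕜] {Ω : Type u} {F : Submodule 𝕜 (Ω → 𝕜)}

theorem continuous_pointwiseTopology_apply (F : Submodule 𝕜 (Ω → 𝕜)) (x : Ω) :
    @Continuous F 𝕜 (pointwiseTopology F) _ fun f => (f : Ω → 𝕜) x :=
  let _ := pointwiseTopology F
  (continuous_apply x).comp continuous_induced_dom

/-- Point evaluation at `x ∈ Ω`, as an element of `F'_{ℬ,τ'}`. -/
noncomputable def pointEval (τ τ' : TopologicalSpace F) (hp : τ' ≤ pointwiseTopology F) (x : Ω) :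
    BoundedDual 𝕜 τ τ' :=
  BoundedDual.ofDual τ τ' (LinearMap.proj x ∘ₗ F.subtype)
    (continuous_le_dom hp (continuous_pointwiseTopology_apply F x))

theorem toDual_pointEval {τ τ' : TopologicalSpace F} (hp : τ' ≤ pointwiseTopology F) (x : Ω)
    (f : F) : BoundedDual.toDual τ τ' (pointEval τ τ' hp x) f = (f : Ω → 𝕜) x :=
  rfl

theorem predual_representative_unique {τ : TopologicalSpace F} {Z : Type*} [AddCommGroup Z]
    [Module 𝕜 Z] {τZ : TopologicalSpace Z} (hZ : IsLCHausdorff 𝕜 τZ) (φ : F ≃L[𝕜] StrongDual 𝕜 Z)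
    {x : Ω} {z₁ z₂ : Z} (h₁ : ∀ f : F, (f : Ω → 𝕜) x = φ f z₁)
    (h₂ : ∀ f : F, (f : Ω → 𝕜) x = φ f z₂) : z₁ = z₂ := by
  have := hZ.polynormableSpace
  have := hZ.t2Space
  exact predualEmbedding_injective φ
    (predualEmbedding_eq_iff.2 fun f => (h₁ f).symm.trans (h₂ f))

theorem exists_representative_of_hasStronglyUniquePredual {τ' τ : TopologicalSpace F}
    (hp : τ' ≤ pointwiseTopology F) {C : SpaceClass.{u} 𝕜} (hmem : C (BoundedDual 𝕜 τ τ'))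
    (J : PredualMap 𝕜 τ (BoundedDual 𝕜 τ τ')) (hJ : ∀ f l, J f l = BoundedDual.toDual τ τ' l f)
    (h : HasStronglyUniquePredual 𝕜 τ C) (Z : Type u) [AddCommGroup Z] [Module 𝕜 Z]
    [TopologicalSpace Z] (φ : PredualMap 𝕜 τ Z) (hZ : C Z) (x : Ω) :
    ∃ z : Z, ∀ f : F, (f : Ω → 𝕜) x = φ f z := by
  -- This `α` sends `φ f` to `J f`, so `J f = φ f ∘ e`; evaluating at `δ_x` gives `f x`.
  obtain ⟨e, he⟩ := h.2 (BoundedDual 𝕜 τ τ') Z hmem hZ J φ (φ.symm.trans J)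
  refine ⟨e (pointEval τ τ' hp x), fun f => ?_⟩
  have := congrArg (fun u => u (pointEval τ τ' hp x)) (he (φ f))
  simp only [ContinuousLinearEquiv.trans_apply, ContinuousLinearEquiv.symm_apply_apply, hJ,
    toDual_pointEval] at this
  exact this

theorem exists_equiv_of_representatives {τ : TopologicalSpace F} (hτ : IsLCHausdorff 𝕜 τ)
    {C : SpaceClass.{u} 𝕜} (hC : C.CompleteBarrelled)
    (h : ∀ (Z : Type u) [AddCommGroup Z] [Module 𝕜 Z] [TopologicalSpace Z] (φ : PredualMap 𝕜 τ Z),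
      C Z → ∀ x : Ω, ∃ z : Z, ∀ f : F, (f : Ω → 𝕜) x = φ f z)
    (Y Z : Type u) [AddCommGroup Y] [Module 𝕜 Y] [TopologicalSpace Y]
    [AddCommGroup Z] [Module 𝕜 Z] [TopologicalSpace Z] (hY : C Y) (hZ : C Z)
    (φ : PredualMap 𝕜 τ Y) (α : StrongDual 𝕜 Z ≃L[𝕜] StrongDual 𝕜 Y) :
    ∃ e : Y ≃L[𝕜] Z, ∀ z' : StrongDual 𝕜 Z, α z' = z'.comp (e : Y →L[𝕜] Z) := by
  have := hτ.continuousSMul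
  choose y hy using h Y φ hY
  choose z hz using h Z (φ.trans α.symm) hZ
  -- Using `α.symm ∘ φ` as predual map for `Z` makes compatibility of the pairings say that `e` has
  -- transpose `α`.
  obtain ⟨e, he⟩ := exists_equiv_of_preduals (hC Y hY) (hC Z hZ) φ (φ.trans α.symm) y z
    (fun f i => by rw [← hz, ← hy])
    (fun f hf => Subtype.ext <| funext fun i => by rw [hy, hf]; rfl)
  refine ⟨e, fun z' => ContinuousLinearMap.ext fun w => ?_⟩
  have := he (φ.symm (α z')) w
  simpa using this.symm

end Preduals

theorem mainTheorem10 {𝕜 : Type} [RCLike 𝕜] {Ω : Type u} [Nonempty Ω]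
    (F : Submodule 𝕜 (Ω → 𝕜)) (τ τ' : TopologicalSpace F)
    (hτ : IsLCHausdorff 𝕜 τ) (hborn : IsBornological 𝕜 τ) (hBC : IsBCSpace 𝕜 τ)
    (hτ' : IsLCHausdorff 𝕜 τ')
    -- `τ'` is finer than pointwise convergence (in Mathlib's order finer topologies are smaller)
    (hp : τ' ≤ pointwiseTopology F)
    (hBBC : BBC 𝕜 τ τ') (hCNC : CNC 𝕜 τ τ')
    (C : SpaceClass.{u} 𝕜) (hC : C.CompleteBarrelled) (hiso : C.ClosedUnderIso)
    (hmem : C (BoundedDual 𝕜 τ τ')) :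
    (HasStronglyUniquePredual 𝕜 τ C ↔
      ∀ (Z : Type u) [AddCommGroup Z] [Module 𝕜 Z] [TopologicalSpace Z] (φ : PredualMap 𝕜 τ Z),
        C Z → ∀ x : Ω, ∃ z : Z, ∀ f : F, (f : Ω → 𝕜) x = φ f z) ∧
    -- uniqueness of the representing vector `z`
    (∀ (Z : Type u) [AddCommGroup Z] [Module 𝕜 Z] [TopologicalSpace Z] (φ : PredualMap 𝕜 τ Z),
        C Z → ∀ (x : Ω) (z₁ z₂ : Z),
          (∀ f : F, (f : Ω → 𝕜) x = φ f z₁) → (∀ f : F, (f : Ω → 𝕜) x = φ f z₂) → z₁ = z₂) := by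

  obtain ⟨J, hJ⟩ := BoundedDual.exists_equiv_strongDual hτ hborn hτ' hBBC hCNC
  exact ⟨⟨exists_representative_of_hasStronglyUniquePredual hp hmem J hJ, fun h =>
      ⟨⟨BoundedDual 𝕜 τ τ', inferInstance, inferInstance, inferInstance,
        (hC _ hmem).toIsLCHausdorff, ⟨J⟩⟩,
      fun Y Z _ _ _ _ _ _ hY hZ φ _ => exists_equiv_of_representatives hτ hC h Y Z hY hZ φ⟩⟩,
    fun Z _ _ _ φ hZ x z₁ z₂ => predual_representative_unique (hC Z hZ).toIsLCHausdorff φ⟩
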